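/- Setting. A player has $n$ samples. Its true parameters are a random pair $(\theta,\varepsilon)\sim\Theta$ with $\varepsilon\ge 0$ and $\mu_e=\mathbb E[\varepsilon]<\infty$. For $m\in\mathbb R$, $v\ge 0$ let $\mathcal D(m,v)$ be a distribution on $\mathbb R$ with mean $m$ and variance $v$, depending measurably on $(m,v)$. *Linear regression.* Here $\theta\in\mathbb R^D$. Independently of $(\theta,\varepsilon)$, the player draws $n$ i.i.d. input points from a distribution $\mathcal X$ on $\mathbb R^D$ with finite second moments and second-moment matrix $\Sigma=\mathbb E_{x\sim\mathcal X}[xx^T]$; they are the rows of the $n\times D$ matrix $X$. Given $(\theta,\varepsilon)$ and $X$, the labels $Y_1,\dots,Y_n$ are independent with $Y_i\sim\mathcal D(X_i^T\theta,\varepsilon)$, where $X_i$ is the $i$-th input point. The local estimate is the ordinary least squares estimate $\hat\theta=(X^TX)^{-1}X^TY$, and the expected MSE of local estimation is $\mathbb E[(x^T\hat\theta-x^T\theta)^2]$, where $x\sim\mathcal X$ is a test point independent of everything else and the expectation is over $(\theta,\varepsilon)$, $X$, $Y$ and $x$. *Mean estimation.* Here $\theta\in\mathbb R$, the player draws $n\ge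 1$ samples $Y_1,\dots,Y_n$ that are i.i.d. from $\mathcal D(\theta,\varepsilon)$ given $(\theta,\varepsilon)$, the local estimate is $\hat\theta=\frac1n\sum_i Y_i$, and the expected MSE is $\mathbb E[(\hat\theta-\theta)^2]$. Theorem. 1. For linear regression, if $X^TX$ is invertible with probability $1$ and the entries of $(X^TX)^{-1}$ are integrable, the expected MSE of local estimation is finite and equals $$\mu_e\cdot\operatorname{tr}\left[\Sigma\,\mathbb E\left[(X^TX)^{-1}\right]\right].$$ 2. If $\mathcal X$ is a $D$-dimensional multivariate normal distribution with mean $0$ and nonsingular covariance matrix, and $n>D+1$, the expected MSE of local estimation is finite and equals $$\frac{\mu_e}{n-D-1}\,D.$$ 3. For mean estimation with $n\ge1$ samples, the expected MSE is finite and equals $\mu_e/n$. The same value is obtained for linear regression with $D=1$ and $n\ge 1$ when the input $x$ is deterministically $1$. -/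

import Mathlib

open MeasureTheory ProbabilityTheory Matrix

noncomputable section

namespace LocalEstimation

/-- The law of the product of finitely many independent random variables, the `i`-th one with law
`κ i a`, as a Markov kernel in the parameter `a`. -/
def productKernel {α : Type*} [MeasurableSpace α] {n : ℕ} (κ : Fin n → Kernel α ℝ)
    [∀ i, IsMarkovKernel (κ i)] : Kernel α (Fin n → ℝ) where
  toFun a := Measure.pi fun i => κ i a
  measurable' := by
    refine Measurable.measure_of_isPiSystem_of_isProbabilityMeasure generateFrom_pi.symm
      isPiSystem_pi ?_
    rintro _ ⟨s, hs, rfl⟩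
    simp only [Measure.pi_pi]
    exact Finset.measurable_prod _ fun i _ => (κ i).measurable_coe (hs i (Set.mem_univ i))

/-- `Θ` is an admissible law for the pair (true parameter, noise variance) of a player: a
probability measure under which the noise variance is nonnegative and has finite expectation. -/
structure IsParameterLaw {E : Type*} [MeasurableSpace E] (Θ : Measure (E × ℝ)) : Prop where
  isProbabilityMeasure : IsProbabilityMeasure Θ
  noise_nonneg : ∀ᵐ p ∂Θ, 0 ≤ p.2
  noise_integrable : Integrable (fun p => p.2) Θ

/-- The expected noise variance `μ_e`. -/
def expectedNoise {E : Type*} [MeasurableSpace E] (Θ : Measure (E × ℝ)) : ℝ :=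
  ∫ p, p.2 ∂Θ

/-- A family of distributions on `ℝ` in which the member with index `(m, v)`, `v ≥ 0`, has mean `m`
and variance `v`. -/
structure IsSamplingFamily (𝒟 : Kernel (ℝ × ℝ) ℝ) : Prop where
  memLp : ∀ m v : ℝ, 0 ≤ v → MemLp id 2 (𝒟 (m, v))
  mean_eq : ∀ m v : ℝ, 0 ≤ v → ∫ y, y ∂(𝒟 (m, v)) = m
  variance_eq : ∀ m v : ℝ, 0 ≤ v → variance id (𝒟 (m, v)) = v

/-- The second-moment matrix `Σ = E[x xᵀ]` of an input distribution. -/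
def secondMoment {D : ℕ} (𝒳 : Measure (EuclideanSpace ℝ (Fin D))) : Matrix (Fin D) (Fin D) ℝ :=
  Matrix.of fun a b => ∫ x, x a * x b ∂𝒳

/-- The `n × D` matrix whose rows are the input points. -/
def designMatrix {n D : ℕ} (X : Fin n → EuclideanSpace ℝ (Fin D)) :
    Matrix (Fin n) (Fin D) ℝ :=
  Matrix.of fun i d => X i d

/-- The matrix `Xᵀ X`. -/
def gram {n D : ℕ} (X : Fin n → EuclideanSpace ℝ (Fin D)) : Matrix (Fin D) (Fin D) ℝ :=
  (designMatrix X)ᵀ * designMatrix X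

/-- The law of `n` independent input points drawn from `𝒳`. -/
def inputLaw {D : ℕ} (n : ℕ) (𝒳 : Measure (EuclideanSpace ℝ (Fin D))) :
    Measure (Fin n → EuclideanSpace ℝ (Fin D)) :=
  Measure.pi fun _ => 𝒳

/-- The entrywise expectation `E[(Xᵀ X)⁻¹]` over `n` independent input points. -/
def expectedInvGram {D : ℕ} (n : ℕ) (𝒳 : Measure (EuclideanSpace ℝ (Fin D))) :
    Matrix (Fin D) (Fin D) ℝ :=
  Matrix.of fun a b => ∫ X, (gram X)⁻¹ a b ∂(inputLaw n 𝒳)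

/-- The ordinary least squares estimate `(Xᵀ X)⁻¹ Xᵀ y`. -/
def ols {n D : ℕ} (X : Fin n → EuclideanSpace ℝ (Fin D)) (y : Fin n → ℝ) :
    EuclideanSpace ℝ (Fin D) :=
  WithLp.toLp 2 (((gram X)⁻¹ * (designMatrix X)ᵀ) *ᵥ y)

/-- Given the parameters `(θ, ε)` and the inputs `X`, the labels are independent, and the `i`-th one
is drawn from `𝒟 ((X i)ᵀ θ, ε)`. -/
def labelKernel (n D : ℕ) (𝒟 : Kernel (ℝ × ℝ) ℝ) [IsMarkovKernel 𝒟] :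
    Kernel ((EuclideanSpace ℝ (Fin D) × ℝ) × (Fin n → EuclideanSpace ℝ (Fin D))) (Fin n → ℝ) :=
  productKernel fun i =>
    𝒟.comap (fun p => (inner ℝ (p.2 i) p.1.1, p.1.2)) (by fun_prop)

/-- The joint law of `((((θ, ε), X), y), x)`: the parameters `(θ, ε) ∼ Θ`, the `n` training inputs
`X ∼ 𝒳`, the training labels `y`, and a new test point `x ∼ 𝒳`. -/
def regressionLaw {D : ℕ} (n : ℕ) (Θ : Measure (EuclideanSpace ℝ (Fin D) × ℝ))
    (𝒳 : Measure (EuclideanSpace ℝ (Fin D))) (𝒟 : Kernel (ℝ × ℝ) ℝ) [IsMarkovKernel 𝒟] :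
    Measure ((((EuclideanSpace ℝ (Fin D) × ℝ) × (Fin n → EuclideanSpace ℝ (Fin D))) ×
      (Fin n → ℝ)) × EuclideanSpace ℝ (Fin D)) :=
  ((Θ.prod (inputLaw n 𝒳)) ⊗ₘ labelKernel n D 𝒟).prod 𝒳

/-- The squared error `(xᵀ θ̂ - xᵀ θ)²` of the local OLS estimate `θ̂` at the test point `x`. -/
def regressionSqError {n D : ℕ} (ω : (((EuclideanSpace ℝ (Fin D) × ℝ) ×
    (Fin n → EuclideanSpace ℝ (Fin D))) × (Fin n → ℝ)) × EuclideanSpace ℝ (Fin D)) : ℝ :=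
  (inner ℝ ω.2 (ols ω.1.1.2 ω.1.2) - inner ℝ ω.2 ω.1.1.1.1) ^ 2

/-- The expected mean squared error of local estimation exists (is finite) and equals `c`, in the
linear regression problem. -/
def HasRegressionMSE {D : ℕ} (n : ℕ) (Θ : Measure (EuclideanSpace ℝ (Fin D) × ℝ))
    (𝒳 : Measure (EuclideanSpace ℝ (Fin D))) (𝒟 : Kernel (ℝ × ℝ) ℝ) [IsMarkovKernel 𝒟]
    (c : ℝ) : Prop :=
  Integrable regressionSqError (regressionLaw n Θ 𝒳 𝒟) ∧
    ∫ ω, regressionSqError ω ∂(regressionLaw n Θ 𝒳 𝒟) = c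

/-- The joint law of `((θ, ε), y)` in mean estimation: the parameters `(θ, ε) ∼ Θ` and then `n`
independent samples `y` from `𝒟 (θ, ε)`. -/
def meanLaw (n : ℕ) (Θ : Measure (ℝ × ℝ)) (𝒟 : Kernel (ℝ × ℝ) ℝ) [IsMarkovKernel 𝒟] :
    Measure ((ℝ × ℝ) × (Fin n → ℝ)) :=
  Θ ⊗ₘ productKernel fun _ : Fin n => 𝒟

/-- The squared error of the sample mean as an estimate of the true mean. -/
def meanSqError {n : ℕ} (ω : (ℝ × ℝ) × (Fin n → ℝ)) : ℝ :=
  ((∑ i, ω.2 i) / n - ω.1.1) ^ 2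

/-- The expected mean squared error of local estimation exists (is finite) and equals `c`, in the
mean estimation problem. -/
def HasMeanMSE (n : ℕ) (Θ : Measure (ℝ × ℝ)) (𝒟 : Kernel (ℝ × ℝ) ℝ) [IsMarkovKernel 𝒟]
    (c : ℝ) : Prop :=
  Integrable meanSqError (meanLaw n Θ 𝒟) ∧ ∫ ω, meanSqError ω ∂(meanLaw n Θ 𝒟) = c

end LocalEstimation

end

/-! Write `G = Xᵀ X`. When `G` is invertible, least squares reproduces `θ` exactly from noiseless
labels, so the prediction error at `x` is a weighted sum of the centred label noises with weights `w
= X G⁻¹ x` (`inner_ols_sub_inner`). Given the parameters and inputs the noises are independent with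
common variance `ε`, so the conditional expected squared error is `ε ‖w‖² = ε xᵀ G⁻¹ x`
(`lintegral_pi_sq_weighted_sum`, `sum_sq_noiseWeights`). Independence of `ε`, `X` and `x` then
factors the expectation into `μ_e` times a trace (`hasRegressionMSE_of_integrable`).

For Gaussian inputs, whitening by the square root of the covariance reduces everything to standard
Gaussian rows, and the covariance cancels from the trace. The columns of a standard Gaussian design
are independent standard Gaussian vectors in `ℝⁿ`, and a diagonal entry of `G⁻¹` is the inverse
squared distance from one column to the span of the others (`inv_gram_apply_self`). Given the
others, that distance is the norm of a standard Gaussian in dimension `n - D + 1`, whose inverse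
square has mean `1 / (n - D - 1)` (`lintegral_inv_gram_apply_self`).

Mean estimation uses the same noise computation with all weights `1 / n`; the constant input is a
case of the general regression formula. -/

namespace LocalEstimation

/-! ### Variance of weighted independent noise -/

section Noise

/-- The second moment of a weighted sum of independent centered variables of common variance. -/
lemma lintegral_pi_sq_weighted_sum {n : ℕ} (ν : Fin n → Measure ℝ) [∀ i, IsProbabilityMeasure (ν i)]
    (m w : Fin n → ℝ) (v : ℝ) (hν : ∀ i, MemLp id 2 (ν i)) (hm : ∀ i, ∫ y, y ∂(ν i) = m i)
    (hv : ∀ i, variance id (ν i) = v) :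
    ∫⁻ y, ENNReal.ofReal ((∑ i, w i * (y i - m i)) ^ 2) ∂(Measure.pi ν) =
      ENNReal.ofReal (v * ∑ i, w i ^ 2) := by
  have hsub : ∀ i, MemLp (fun y : ℝ => y - m i) 2 (ν i) := fun i => (hν i).sub (memLp_const _)
  have hX : ∀ i, MemLp (fun y : ℝ => w i * (y - m i)) 2 (ν i) := fun i => (hsub i).const_mul _
  have hX' : ∀ i, MemLp (fun y : Fin n → ℝ => w i * (y i - m i)) 2 (Measure.pi ν) :=
    fun i => (hX i).comp_measurePreserving (measurePreserving_eval ν i)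
  have hS : MemLp (fun y : Fin n → ℝ => ∑ i, w i * (y i - m i)) 2 (Measure.pi ν) :=
    memLp_finsetSum _ fun i _ => hX' i
  have hmean : ∫ y, (∑ i, w i * (y i - m i)) ∂(Measure.pi ν) = 0 := by
    rw [integral_finsetSum _ fun i _ => (hX' i).integrable one_le_two]
    refine Finset.sum_eq_zero fun i _ => ?_
    rw [integral_comp_eval (μ := ν) (i := i) (f := fun y => w i * (y - m i))
        (hX i).aestronglyMeasurable,
      integral_const_mul, integral_sub (f := fun y : ℝ => y)
        ((hν i).integrable one_le_two) (integrable_const _)]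
    simp [hm i]
  -- The sum is centred, so its second moment is its variance, which is additive over independent
  -- terms.
  rw [← ofReal_integral_eq_lintegral_ofReal hS.integrable_sq (ae_of_all _ fun _ => sq_nonneg _),
    ← variance_of_integral_eq_zero hS.aestronglyMeasurable.aemeasurable hmean]
  congr 1
  have := variance_sum_pi (μ := ν) (X := fun i y => w i * (y - m i)) hX
  rw [Finset.sum_fn] at this
  rw [this, Finset.mul_sum]
  refine Finset.sum_congr rfl fun i _ => ?_
  rw [variance_const_mul, variance_sub_const (X := fun y : ℝ => y) (hν i).aestronglyMeasurable,
    mul_comm]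
  exact congrArg (· * _) (hv i)

end Noise

/-! ### Algebra and measurability of the least squares estimate -/

section Design

variable {n D : ℕ}

lemma gram_apply (X : Fin n → EuclideanSpace ℝ (Fin D)) (a b : Fin D) :
    gram X a b = ∑ i, X i a * X i b := by
  simp [gram, Matrix.mul_apply, designMatrix]

lemma gram_isSymm (X : Fin n → EuclideanSpace ℝ (Fin D)) : (gram X).IsSymm := by
  simp [gram, Matrix.IsSymm, Matrix.transpose_mul]

lemma measurable_det_real {α ι : Type*} [MeasurableSpace α] [Fintype ι] [DecidableEq ι]
    {M : α → Matrix ι ι ℝ} (hM : ∀ a b, Measurable fun t => M t a b) :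
    Measurable fun t => (M t).det := by
  simp only [Matrix.det_apply]
  exact Finset.measurable_sum _ fun σ _ =>
    (Finset.measurable_prod _ fun i _ => hM _ _).const_smul _

lemma measurable_inv_apply {α : Type*} [MeasurableSpace α] {ι : Type*} [Fintype ι] [DecidableEq ι]
    {M : α → Matrix ι ι ℝ} (hM : ∀ a b, Measurable fun t => M t a b) (a b : ι) :
    Measurable fun t => (M t)⁻¹ a b := by
  have hadj : Measurable fun t => (M t).adjugate a b := by
    simp only [Matrix.adjugate_apply]
    refine measurable_det_real fun i j => ?_
    simp only [Matrix.updateRow_apply]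
    split_ifs
    · exact measurable_const
    · exact hM i j
  simp only [Matrix.inv_def, Matrix.smul_apply, Ring.inverse_eq_inv', smul_eq_mul]
  exact (measurable_det_real hM).inv.mul hadj

lemma measurable_gram_apply (a b : Fin D) :
    Measurable fun X : Fin n → EuclideanSpace ℝ (Fin D) => gram X a b := by
  simp only [gram_apply]
  fun_prop

lemma measurable_inv_gram_apply (a b : Fin D) :
    Measurable fun X : Fin n → EuclideanSpace ℝ (Fin D) => (gram X)⁻¹ a b :=
  measurable_inv_apply measurable_gram_apply a b

lemma ols_apply (X : Fin n → EuclideanSpace ℝ (Fin D)) (y : Fin n → ℝ) (a : Fin D) :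
    ols X y a = ∑ i, (∑ b, (gram X)⁻¹ a b * X i b) * y i := by
  simp [ols, Matrix.mulVec, dotProduct, Matrix.mul_apply, designMatrix]

lemma measurable_regressionSqError :
    Measurable (regressionSqError : (((EuclideanSpace ℝ (Fin D) × ℝ) ×
      (Fin n → EuclideanSpace ℝ (Fin D))) × (Fin n → ℝ)) × EuclideanSpace ℝ (Fin D) → ℝ) := by
  unfold regressionSqError
  refine Measurable.pow_const (Measurable.sub ?_ (by fun_prop)) 2
  simp only [PiLp.inner_apply, ols_apply, RCLike.inner_apply, conj_trivial]
  refine Finset.measurable_sum _ fun a _ => Measurable.mul ?_ (by fun_prop)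
  refine Finset.measurable_sum _ fun i _ => Measurable.mul ?_ (by fun_prop)
  refine Finset.measurable_sum _ fun b _ => Measurable.mul ?_ (by fun_prop)
  exact (measurable_inv_gram_apply a b).comp (by fun_prop)

/-- The weights with which the label noise enters the prediction at the point `x`. -/
noncomputable def noiseWeights (X : Fin n → EuclideanSpace ℝ (Fin D))
    (x : EuclideanSpace ℝ (Fin D)) : Fin n → ℝ :=
  designMatrix X *ᵥ ((gram X)⁻¹ *ᵥ ⇑x)

/-- With `w = X G⁻¹ x`, the middle factor of `wᵀ w = xᵀ G⁻¹ (Xᵀ X) G⁻¹ x` cancels one inverse. -/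
lemma sum_sq_noiseWeights {X : Fin n → EuclideanSpace ℝ (Fin D)} (hX : IsUnit (gram X))
    (x : EuclideanSpace ℝ (Fin D)) :
    ∑ i, noiseWeights X x i ^ 2 = ∑ a, ∑ b, (gram X)⁻¹ a b * (x a * x b) := by
  have h1 : ∑ i, noiseWeights X x i ^ 2 = noiseWeights X x ⬝ᵥ noiseWeights X x := by
    simp [dotProduct, sq]
  have h2 : noiseWeights X x ⬝ᵥ noiseWeights X x = ⇑x ⬝ᵥ ((gram X)⁻¹ *ᵥ ⇑x) := by
    unfold noiseWeights
    rw [Matrix.dotProduct_mulVec, ← Matrix.mulVec_transpose, Matrix.mulVec_mulVec]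
    change (gram X *ᵥ _) ⬝ᵥ _ = _
    rw [Matrix.mulVec_mulVec, Matrix.mul_nonsing_inv _ ((Matrix.isUnit_iff_isUnit_det _).1 hX),
      Matrix.one_mulVec]
  rw [h1, h2]
  simp only [dotProduct, Matrix.mulVec, Finset.mul_sum]
  exact Finset.sum_congr rfl fun a _ => Finset.sum_congr rfl fun b _ => by ring

/-- Since `G⁻¹ Xᵀ X = 1`, the estimate applied to the noiseless labels `X θ` returns `θ`; by
linearity only the label noise survives. -/
lemma inner_ols_sub_inner {X : Fin n → EuclideanSpace ℝ (Fin D)} (hX : IsUnit (gram X))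
    (x θ : EuclideanSpace ℝ (Fin D)) (y : Fin n → ℝ) :
    inner ℝ x (ols X y) - inner ℝ x θ =
      ∑ i, noiseWeights X x i * (y i - inner ℝ (X i) θ) := by
  have hlabel : (fun i => inner ℝ (X i) θ) = designMatrix X *ᵥ ⇑θ := by
    ext i
    simp [designMatrix, Matrix.mulVec, dotProduct, PiLp.inner_apply, mul_comm]
  have hinner : ∀ u : EuclideanSpace ℝ (Fin D), inner ℝ x u = ⇑x ⬝ᵥ ⇑u := fun u => by
    simp [dotProduct, PiLp.inner_apply, mul_comm]
  have hols : ∀ z : Fin n → ℝ, ⇑x ⬝ᵥ (((gram X)⁻¹ * (designMatrix X)ᵀ) *ᵥ z) =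
      noiseWeights X x ⬝ᵥ z := fun z => by
    rw [Matrix.dotProduct_mulVec, ← Matrix.mulVec_transpose, Matrix.transpose_mul,
      Matrix.transpose_transpose, Matrix.transpose_nonsing_inv, (gram_isSymm X).eq,
      ← Matrix.mulVec_mulVec]
    rfl
  have hθ : noiseWeights X x ⬝ᵥ (designMatrix X *ᵥ ⇑θ) = ⇑x ⬝ᵥ ⇑θ := by
    rw [← hols, Matrix.mulVec_mulVec, Matrix.mul_assoc]
    change ⇑x ⬝ᵥ (((gram X)⁻¹ * gram X) *ᵥ _) = _
    rw [Matrix.nonsing_inv_mul _ ((Matrix.isUnit_iff_isUnit_det _).1 hX), Matrix.one_mulVec]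
  have hsum : ∑ i, noiseWeights X x i * (y i - inner ℝ (X i) θ) =
      noiseWeights X x ⬝ᵥ (y - designMatrix X *ᵥ ⇑θ) := by
    rw [← hlabel]
    rfl
  rw [hsum, dotProduct_sub, hθ, hinner, hinner, ← hols]
  rfl

end Design

/-! ### Regression error for a general input distribution -/

section Regression

variable {n D : ℕ}

lemma lintegral_labelKernel_regressionSqError {𝒟 : Kernel (ℝ × ℝ) ℝ} [IsMarkovKernel 𝒟]
    (h𝒟 : IsSamplingFamily 𝒟) {p : EuclideanSpace ℝ (Fin D) × ℝ} (hp : 0 ≤ p.2)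
    {X : Fin n → EuclideanSpace ℝ (Fin D)} (hX : IsUnit (gram X)) (x : EuclideanSpace ℝ (Fin D)) :
    ∫⁻ y, ENNReal.ofReal (regressionSqError (((p, X), y), x)) ∂(labelKernel n D 𝒟 (p, X)) =
      ENNReal.ofReal (p.2 * ∑ a, ∑ b, (gram X)⁻¹ a b * (x a * x b)) := by
  rw [← sum_sq_noiseWeights hX]
  simp only [regressionSqError, inner_ols_sub_inner hX]
  exact lintegral_pi_sq_weighted_sum (fun i => 𝒟 (inner ℝ (X i) p.1, p.2)) _ _ _
    (fun i => h𝒟.memLp _ _ hp) (fun i => h𝒟.mean_eq _ _ hp) (fun i => h𝒟.variance_eq _ _ hp)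

/-- Lets one Tonelli computation in `ENNReal` deliver finiteness and value together. -/
lemma integrable_and_integral_eq_of_lintegral_ofReal {α : Type*} [MeasurableSpace α]
    {μ : Measure α} {f : α → ℝ} (hf : Measurable f) (h0 : ∀ a, 0 ≤ f a) {c : ℝ} (hc : 0 ≤ c)
    (h : ∫⁻ a, ENNReal.ofReal (f a) ∂μ = ENNReal.ofReal c) :
    Integrable f μ ∧ ∫ a, f a ∂μ = c := by
  refine ⟨⟨hf.aestronglyMeasurable, ?_⟩, ?_⟩
  · rw [hasFiniteIntegral_iff_ofReal (ae_of_all _ h0), h]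
    exact ENNReal.ofReal_lt_top
  · rw [integral_eq_lintegral_of_nonneg_ae (ae_of_all _ h0) hf.aestronglyMeasurable, h,
      ENNReal.toReal_ofReal hc]

/-- The expected squared error of ordinary least squares for a general input distribution. -/
lemma hasRegressionMSE_of_integrable {𝒟 : Kernel (ℝ × ℝ) ℝ} [IsMarkovKernel 𝒟]
    (h𝒟 : IsSamplingFamily 𝒟) {Θ : Measure (EuclideanSpace ℝ (Fin D) × ℝ)}
    (hΘ : IsParameterLaw Θ) {𝒳 : Measure (EuclideanSpace ℝ (Fin D))} [IsProbabilityMeasure 𝒳]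
    (h𝒳 : ∀ d, MemLp (fun x : EuclideanSpace ℝ (Fin D) => x d) 2 𝒳)
    (hunit : ∀ᵐ X ∂(inputLaw n 𝒳), IsUnit (gram X))
    (hint : ∀ a b, Integrable (fun X => (gram X)⁻¹ a b) (inputLaw n 𝒳)) :
    HasRegressionMSE n Θ 𝒳 𝒟
      (expectedNoise Θ * (secondMoment 𝒳 * expectedInvGram n 𝒳).trace) := by
  have := hΘ.isProbabilityMeasure
  have : IsProbabilityMeasure (inputLaw n 𝒳) := by unfold inputLaw; infer_instance
  have : IsMarkovKernel (labelKernel n D 𝒟) :=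
    ⟨fun a => by change IsProbabilityMeasure (Measure.pi _); infer_instance⟩
  have hprod : ∀ a b, Integrable (fun x : EuclideanSpace ℝ (Fin D) => x a * x b) 𝒳 :=
    fun a b => (h𝒳 a).integrable_mul (h𝒳 b)
  -- `F` is the expected squared error conditional on parameters, training inputs and test point, on
  -- the event that `ε ≥ 0` and the Gram matrix is invertible.
  let F : ((EuclideanSpace ℝ (Fin D) × ℝ) × (Fin n → EuclideanSpace ℝ (Fin D))) ×
      EuclideanSpace ℝ (Fin D) → ℝ :=
    fun t => t.1.1.2 * ∑ a, ∑ b, (gram t.1.2)⁻¹ a b * (t.2 a * t.2 b)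
  have hF : F = fun t => ∑ a, ∑ b, (t.1.1.2 * (gram t.1.2)⁻¹ a b) * (t.2 a * t.2 b) := by
    funext t
    simp only [F, Finset.mul_sum, mul_assoc]
  have hFint : ∀ a b, Integrable (fun t : ((EuclideanSpace ℝ (Fin D) × ℝ) ×
      (Fin n → EuclideanSpace ℝ (Fin D))) × EuclideanSpace ℝ (Fin D) =>
      (t.1.1.2 * (gram t.1.2)⁻¹ a b) * (t.2 a * t.2 b)) ((Θ.prod (inputLaw n 𝒳)).prod 𝒳) :=
    fun a b => (hΘ.noise_integrable.mul_prod (hint a b)).mul_prod (hprod a b)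
  have hFI : Integrable F ((Θ.prod (inputLaw n 𝒳)).prod 𝒳) := by
    rw [hF]
    exact integrable_finsetSum _ fun a _ => integrable_finsetSum _ fun b _ => hFint a b
  have hgood : ∀ᵐ q ∂(Θ.prod (inputLaw n 𝒳)), 0 ≤ q.1.2 ∧ IsUnit (gram q.2) :=
    (Measure.quasiMeasurePreserving_fst.ae hΘ.noise_nonneg).and
      (Measure.quasiMeasurePreserving_snd.ae hunit)
  have hF0 : 0 ≤ᵐ[(Θ.prod (inputLaw n 𝒳)).prod 𝒳] F := by
    filter_upwards [Measure.quasiMeasurePreserving_fst.ae hgood] with t ht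
    have := sum_sq_noiseWeights ht.2 t.2
    exact mul_nonneg ht.1 (this ▸ Finset.sum_nonneg fun i _ => sq_nonneg _)
  have hmeas := (measurable_regressionSqError (n := n) (D := D)).ennreal_ofReal
  have hlint : ∫⁻ ω, ENNReal.ofReal (regressionSqError ω) ∂(regressionLaw n Θ 𝒳 𝒟) =
      ENNReal.ofReal (∫ t, F t ∂((Θ.prod (inputLaw n 𝒳)).prod 𝒳)) := by
    -- The test point is integrated outermost, leaving the labels innermost, where the conditional
    -- variance formula applies.
    rw [ofReal_integral_eq_lintegral_ofReal hFI hF0, regressionLaw,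
      lintegral_prod_symm' _ hmeas, lintegral_prod_symm _ hFI.1.aemeasurable.ennreal_ofReal]
    refine lintegral_congr fun x => ?_
    rw [Measure.lintegral_compProd (f := fun p => ENNReal.ofReal (regressionSqError (p, x)))
      (hmeas.comp measurable_prodMk_right)]
    refine lintegral_congr_ae ?_
    filter_upwards [hgood] with q hq
    exact lintegral_labelKernel_regressionSqError h𝒟 hq.1 hq.2 x
  have hval : ∫ t, F t ∂((Θ.prod (inputLaw n 𝒳)).prod 𝒳) =
      expectedNoise Θ * (secondMoment 𝒳 * expectedInvGram n 𝒳).trace := by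
    rw [hF, integral_finsetSum _ fun a _ => integrable_finsetSum _ fun b _ => hFint a b]
    simp only [integral_finsetSum _ fun b _ => hFint _ b, Matrix.trace, Matrix.diag,
      Matrix.mul_apply, Finset.mul_sum]
    rw [Finset.sum_comm]
    refine Finset.sum_congr rfl fun b _ => Finset.sum_congr rfl fun a _ => ?_
    rw [integral_prod_mul (f := fun q : (EuclideanSpace ℝ (Fin D) × ℝ) ×
        (Fin n → EuclideanSpace ℝ (Fin D)) => q.1.2 * (gram q.2)⁻¹ a b)
        (g := fun x : EuclideanSpace ℝ (Fin D) => x a * x b),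
      integral_prod_mul (f := fun p : EuclideanSpace ℝ (Fin D) × ℝ => p.2)
        (g := fun X : Fin n → EuclideanSpace ℝ (Fin D) => (gram X)⁻¹ a b)]
    simp only [expectedNoise, secondMoment, expectedInvGram, Matrix.of_apply, mul_comm,
      mul_left_comm]
  rw [hval] at hlint
  exact integrable_and_integral_eq_of_lintegral_ofReal measurable_regressionSqError
    (fun ω => sq_nonneg _) (hval ▸ integral_nonneg_of_ae hF0) hlint

end Regression

/-! ### Inverse squared norm of a standard Gaussian vector -/

section InverseSquareNorm

/-- The Gaussian density absorbs the factor, leaving an unnormalised Gaussian integral of rate `t +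
1 / 2`. -/
lemma integral_gaussianReal_exp_neg_mul_sq {t : ℝ} (ht : 0 ≤ t) :
    ∫ y, Real.exp (-t * y ^ 2) ∂(gaussianReal 0 1) = (1 + 2 * t) ^ (-(1 / 2) : ℝ) := by
  rw [integral_gaussianReal_eq_integral_smul one_ne_zero]
  have h : ∀ y : ℝ, gaussianPDFReal 0 1 y • Real.exp (-t * y ^ 2) =
      (√(2 * Real.pi))⁻¹ * Real.exp (-(t + 1 / 2) * y ^ 2) := fun y => by
    rw [gaussianPDFReal, smul_eq_mul, mul_assoc, ← Real.exp_add]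
    simp only [NNReal.coe_one, mul_one, sub_zero]
    ring_nf
  simp only [h]
  rw [integral_const_mul, integral_gaussian, ← Real.sqrt_inv, ← Real.sqrt_mul (by positivity),
    Real.rpow_neg (by positivity), ← Real.sqrt_eq_rpow, ← Real.sqrt_inv]
  congr 1
  have := Real.pi_pos
  field_simp
  ring

variable {E : Type*} [NormedAddCommGroup E] [InnerProductSpace ℝ E] [FiniteDimensional ℝ E]
  [MeasurableSpace E] [BorelSpace E]

lemma integral_stdGaussian_exp_neg_mul_norm_sq {t : ℝ} (ht : 0 ≤ t) :
    ∫ x, Real.exp (-t * ‖x‖ ^ 2) ∂(stdGaussian E) =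
      (1 + 2 * t) ^ (-((Module.finrank ℝ E : ℝ) / 2)) := by
  have hnorm : ∀ x : Fin (Module.finrank ℝ E) → ℝ,
      ‖∑ i, x i • stdOrthonormalBasis ℝ E i‖ ^ 2 = ∑ i, x i ^ 2 := fun x => by
    rw [← real_inner_self_eq_norm_sq, (stdOrthonormalBasis ℝ E).orthonormal.inner_sum]
    simp [sq]
  rw [stdGaussian, integral_map (Measurable.aemeasurable (by fun_prop))
    (Measurable.aestronglyMeasurable (by fun_prop))]
  simp only [hnorm, Finset.mul_sum, Real.exp_sum]
  rw [integral_fintype_prod_eq_prod (f := fun _ y => Real.exp (-t * y ^ 2))]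
  simp only [integral_gaussianReal_exp_neg_mul_sq ht, Finset.prod_const, Finset.card_univ,
    Fintype.card_fin]
  rw [← Real.rpow_natCast, ← Real.rpow_mul (by positivity)]
  congr 1
  ring

lemma lintegral_stdGaussian_exp_neg_mul_norm_sq {t : ℝ} (ht : 0 ≤ t) :
    ∫⁻ x, ENNReal.ofReal (Real.exp (-t * ‖x‖ ^ 2)) ∂(stdGaussian E) =
      ENNReal.ofReal ((1 + 2 * t) ^ (-((Module.finrank ℝ E : ℝ) / 2))) := by
  rw [← integral_stdGaussian_exp_neg_mul_norm_sq ht, ofReal_integral_eq_lintegral_ofReal _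
    (ae_of_all _ fun _ => (Real.exp_pos _).le)]
  refine Integrable.of_bound (Measurable.aestronglyMeasurable (by fun_prop)) 1
    (ae_of_all _ fun x => ?_)
  rw [Real.norm_eq_abs, abs_of_pos (Real.exp_pos _), Real.exp_le_one_iff]
  nlinarith [sq_nonneg ‖x‖]

/-- Represents a reciprocal as a Laplace integral; in `ENNReal` it includes `r = 0`, where both
sides are `∞`. -/
lemma lintegral_Ioi_exp_neg_mul {r : ℝ} (hr : 0 ≤ r) :
    ∫⁻ t in Set.Ioi (0 : ℝ), ENNReal.ofReal (Real.exp (-t * r)) = (ENNReal.ofReal r)⁻¹ := by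
  rcases hr.eq_or_lt with rfl | hr
  · simp
  · have h := integral_exp_mul_Ioi (neg_lt_zero.2 hr) 0
    have hi := integrableOn_exp_mul_Ioi (neg_lt_zero.2 hr) 0
    rw [← ENNReal.ofReal_inv_of_pos hr]
    have : (∫ x in Set.Ioi (0 : ℝ), Real.exp (-r * x)) = r⁻¹ := by
      rw [h]; simp
    rw [← this, ofReal_integral_eq_lintegral_ofReal hi (ae_of_all _ fun _ => (Real.exp_pos _).le)]
    simp only [neg_mul, mul_comm r]

lemma lintegral_Ioi_one_add_two_mul_rpow {k : ℝ} (hk : 2 < k) :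
    ∫⁻ t in Set.Ioi (0 : ℝ), ENNReal.ofReal ((1 + 2 * t) ^ (-(k / 2))) =
      ENNReal.ofReal (1 / (k - 2)) := by
  -- An antiderivative of the integrand. Its exponent is negative because `k > 2`, so it vanishes at
  -- infinity and only `-F 0` contributes.
  let F : ℝ → ℝ := fun t => -(1 / (k - 2)) * (1 + 2 * t) ^ (-(k / 2) + 1)
  have hk' : k - 2 ≠ 0 := by linarith
  have hderiv : ∀ t ∈ Set.Ici (0 : ℝ), HasDerivAt F ((1 + 2 * t) ^ (-(k / 2))) t := fun t ht => by
    have ht0 : (0 : ℝ) ≤ t := ht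
    have h1 : HasDerivAt (fun t : ℝ => 1 + 2 * t) 2 t := by
      simpa using ((hasDerivAt_id t).const_mul 2).const_add 1
    have h2 := (h1.rpow_const (p := -(k / 2) + 1) (Or.inl (by positivity))).const_mul
      (-(1 / (k - 2)))
    refine h2.congr_deriv ?_
    rw [show -(k / 2) + 1 - 1 = -(k / 2) by ring]
    field_simp
    ring
  have hpos : ∀ t ∈ Set.Ioi (0 : ℝ), (0 : ℝ) ≤ (1 + 2 * t) ^ (-(k / 2)) := fun t ht => by
    have ht0 : (0 : ℝ) < t := ht
    positivity
  have hlim : Filter.Tendsto F Filter.atTop (nhds 0) := by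
    have h1 : Filter.Tendsto (fun t : ℝ => 1 + 2 * t) Filter.atTop Filter.atTop :=
      Filter.tendsto_atTop_add_const_left _ _
        (Filter.tendsto_id.const_mul_atTop (by norm_num : (0 : ℝ) < 2))
    have h2 := ((tendsto_rpow_neg_atTop (y := k / 2 - 1) (by linarith)).comp h1).const_mul
      (-(1 / (k - 2)))
    rw [mul_zero] at h2
    refine h2.congr fun t => ?_
    simp only [F, Function.comp_apply]
    congr 2
    ring
  have hval := integral_Ioi_of_hasDerivAt_of_nonneg' hderiv hpos hlim
  have hint := integrableOn_Ioi_deriv_of_nonneg' hderiv hpos hlim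
  rw [← ofReal_integral_eq_lintegral_ofReal hint
    ((ae_restrict_iff' measurableSet_Ioi).2 (ae_of_all _ hpos)), hval]
  simp [F]

/-- The reciprocal of a chi-squared variable with at least three degrees of freedom. -/
lemma lintegral_stdGaussian_inv_norm_sq (hE : 3 ≤ Module.finrank ℝ E) :
    ∫⁻ x, (ENNReal.ofReal (‖x‖ ^ 2))⁻¹ ∂(stdGaussian E) =
      ENNReal.ofReal (1 / ((Module.finrank ℝ E : ℝ) - 2)) := by
  have hk : (2 : ℝ) < Module.finrank ℝ E := by
    have : (3 : ℝ) ≤ Module.finrank ℝ E := by exact_mod_cast hE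
    linarith
  rw [← lintegral_Ioi_one_add_two_mul_rpow hk]
  -- Replacing the reciprocal by its Laplace integral and applying Tonelli reduces the claim to the
  -- Laplace transform of `‖x‖²`.
  simp only [← lintegral_Ioi_exp_neg_mul (sq_nonneg _)]
  rw [lintegral_lintegral_swap (Measurable.aemeasurable (by fun_prop))]
  exact setLIntegral_congr_fun measurableSet_Ioi fun t ht =>
    lintegral_stdGaussian_exp_neg_mul_norm_sq (Set.mem_Ioi.1 ht).le

/-- For `t ∈ V`, pairing `t` with the projection of `x` is pairing `t` with `x`, so the
characteristic functions agree. -/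
lemma map_orthogonalProjectionOnto_stdGaussian (V : Submodule ℝ E) :
    (stdGaussian E).map V.orthogonalProjectionOnto = stdGaussian V := by
  have : IsProbabilityMeasure ((stdGaussian E).map V.orthogonalProjectionOnto) :=
    Measure.isProbabilityMeasure_map (Measurable.aemeasurable (by fun_prop))
  apply Measure.ext_of_charFun
  ext t
  have h := charFun_stdGaussian (t : E)
  rw [charFun_apply] at h
  rw [charFun_stdGaussian, charFun_apply, integral_map (Measurable.aemeasurable (by fun_prop))
    (Measurable.aestronglyMeasurable (by fun_prop))]
  simpa only [Submodule.inner_orthogonalProjectionOnto_eq_of_mem_right, Submodule.coe_norm] using h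

/-- A nonzero `v` orthogonal to `W` gives a nondegenerate real Gaussian `⟨v, x⟩`, which almost
surely differs from `0`, its value on `W`. -/
lemma ae_notMem_stdGaussian {W : Submodule ℝ E} (hW : W ≠ ⊤) : ∀ᵐ x ∂(stdGaussian E), x ∉ W := by
  obtain ⟨v, hv, hv0⟩ := Submodule.exists_mem_ne_zero_of_ne_bot
    (mt (Submodule.orthogonal_eq_bot_iff).1 hW)
  have hmap := IsGaussian.map_eq_gaussianReal (μ := stdGaussian E) (innerSL ℝ v)
  rw [variance_dual_stdGaussian, innerSL_apply_norm] at hmap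
  have hvar : (‖v‖ ^ 2).toNNReal ≠ 0 := by
    simpa [Real.toNNReal_eq_zero] using hv0
  have := nullSingletonClass_gaussianReal (μ := ∫ x, innerSL ℝ v x ∂(stdGaussian E)) hvar
  have h0 : ∀ᵐ y ∂((stdGaussian E).map (innerSL ℝ v)), y ≠ 0 := by
    rw [hmap]
    exact Measure.ae_ne _ _
  filter_upwards [ae_of_ae_map (Measurable.aemeasurable (by fun_prop)) h0] with x hx hxW
  exact hx (by simpa using (W.mem_orthogonal' v).1 hv x hxW)

lemma lintegral_stdGaussian_inv_norm_sq_orthogonalProjectionOnto {V : Submodule ℝ E}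
    (hV : 3 ≤ Module.finrank ℝ V) :
    ∫⁻ x, (ENNReal.ofReal (‖V.orthogonalProjectionOnto x‖ ^ 2))⁻¹ ∂(stdGaussian E) =
      ENNReal.ofReal (1 / ((Module.finrank ℝ V : ℝ) - 2)) := by
  rw [← lintegral_stdGaussian_inv_norm_sq hV, ← map_orthogonalProjectionOnto_stdGaussian V,
    lintegral_map (by fun_prop) (by fun_prop)]

end InverseSquareNorm

/-! ### From independent rows to independent columns -/

section Transpose

/-- The laws are compared on boxes whose sides are themselves boxes; there the two double products
of masses differ only in order. -/
lemma map_pi_pi_swap {ι κ Ω : Type*} [Fintype ι] [Fintype κ] [MeasurableSpace Ω] (μ : Measure Ω)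
    [IsProbabilityMeasure μ] :
    (Measure.pi fun _ : ι => Measure.pi fun _ : κ => μ).map (fun X a i => X i a) =
      Measure.pi fun _ : κ => Measure.pi fun _ : ι => μ := by
  symm
  refine Measure.pi_eq_generateFrom (fun _ => generateFrom_pi) (fun _ => isPiSystem_pi)
    (fun _ => Measure.FiniteSpanningSetsIn.pi fun _ => μ.toFiniteSpanningSetsIn) fun s hs => ?_
  choose t ht hts using hs
  have hpre : (fun (X : ι → κ → Ω) a i => X i a) ⁻¹' (Set.univ.pi s) =
      Set.univ.pi fun i => Set.univ.pi fun a => t a i := by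
    ext X
    simp only [← hts, Set.mem_preimage, Set.mem_pi, Set.mem_univ, true_imp_iff]
    exact forall_comm
  rw [Measure.map_apply (by fun_prop), hpre]
  · simp only [← hts, Measure.pi_pi]
    exact Finset.prod_comm
  · refine MeasurableSet.univ_pi fun a => hts a ▸ MeasurableSet.univ_pi fun i => ?_
    exact ht a i (Set.mem_univ i)

lemma measurePreserving_transpose_stdGaussian (n D : ℕ) :
    MeasurePreserving (fun (X : Fin n → EuclideanSpace ℝ (Fin D)) a =>
        (WithLp.toLp 2 fun i => X i a : EuclideanSpace ℝ (Fin n)))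
      (inputLaw n (stdGaussian (EuclideanSpace ℝ (Fin D))))
      (Measure.pi fun _ : Fin D => stdGaussian (EuclideanSpace ℝ (Fin n))) := by
  have hto : ∀ k : ℕ, MeasurePreserving (WithLp.toLp 2 : (Fin k → ℝ) → EuclideanSpace ℝ (Fin k))
      (Measure.pi fun _ => gaussianReal 0 1) (stdGaussian (EuclideanSpace ℝ (Fin k))) :=
    fun k => ⟨by fun_prop, map_pi_eq_stdGaussian⟩
  have hof : MeasurePreserving (WithLp.ofLp : EuclideanSpace ℝ (Fin D) → Fin D → ℝ)
      (stdGaussian (EuclideanSpace ℝ (Fin D))) (Measure.pi fun _ => gaussianReal 0 1) := by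
    refine ⟨by fun_prop, ?_⟩
    rw [← map_pi_eq_stdGaussian, Measure.map_map (by fun_prop) (by fun_prop)]
    exact Measure.map_id
  have hswap : MeasurePreserving (fun (X : Fin n → Fin D → ℝ) a i => X i a)
      (Measure.pi fun _ => Measure.pi fun _ => gaussianReal 0 1)
      (Measure.pi fun _ => Measure.pi fun _ => gaussianReal 0 1) :=
    ⟨by fun_prop, map_pi_pi_swap _⟩
  exact (measurePreserving_pi _ _ fun _ : Fin D => hto n).comp
    (hswap.comp (measurePreserving_pi _ _ fun _ : Fin n => hof))

end Transpose

/-! ### Entries of an inverse Gram matrix -/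

section GramInverse

variable {E : Type*} [NormedAddCommGroup E] [InnerProductSpace ℝ E]

/-- A diagonal entry of the inverse Gram matrix is the inverse squared distance of a vector to the
span of the others. -/
lemma inv_gram_apply_self {ι : Type*} [Fintype ι] [DecidableEq ι] {c : ι → E}
    (hc : LinearIndependent ℝ c) (a : ι) {W : Submodule ℝ E} [Wᗮ.HasOrthogonalProjection]
    (hW : Submodule.span ℝ (c '' {a}ᶜ) = W) :
    (Matrix.gram ℝ c)⁻¹ a a = (‖Wᗮ.orthogonalProjectionOnto (c a)‖ ^ 2)⁻¹ := by
  subst hW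
  set W := Submodule.span ℝ (c '' {a}ᶜ)
  have hdet : IsUnit (Matrix.gram ℝ c).det :=
    isUnit_iff_ne_zero.2 (Matrix.det_gram_ne_zero_iff_linearIndependent.2 hc)
  set v : ι → ℝ := fun b => (Matrix.gram ℝ c)⁻¹ b a
  -- The coefficients are column `a` of the inverse, so `w` is the dual vector to `c a`: it pairs to
  -- `1` with `c a` and to `0` with the other `c b`.
  set w : E := ∑ b, v b • c b
  have hinner : ∀ b, inner ℝ (c b) w = if b = a then 1 else 0 := fun b => by
    have := congrFun (congrFun (Matrix.mul_nonsing_inv _ hdet) b) a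
    rw [Matrix.mul_apply, Matrix.one_apply] at this
    rw [← this, inner_sum]
    refine Finset.sum_congr rfl fun i _ => ?_
    rw [real_inner_smul_right, mul_comm]
    rfl
  have hwW : w ∈ Wᗮ := by
    rw [Submodule.mem_orthogonal]
    intro u hu
    induction hu using Submodule.span_induction with
    | mem u hu =>
      obtain ⟨b, hb, rfl⟩ := hu
      rw [hinner, if_neg (by simpa using hb)]
    | zero => simp
    | add u u' _ _ h h' => rw [inner_add_left, h, h', add_zero]
    | smul r u _ h => rw [real_inner_smul_left, h, mul_zero]
  have hww : ‖w‖ ^ 2 = v a := by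
    rw [← real_inner_self_eq_norm_sq]
    nth_rw 1 [show w = ∑ b, v b • c b from rfl]
    simp [sum_inner, real_inner_smul_left, hinner]
  -- Projecting onto `Wᗮ` fixes `w` and kills every `c b` with `b ≠ a`. Comparing squared norms with
  -- `‖w‖² = v a` then determines `v a`.
  have hproj : Wᗮ.orthogonalProjectionOnto w = v a • Wᗮ.orthogonalProjectionOnto (c a) := by
    have hz : ∀ b, b ≠ a → Wᗮ.orthogonalProjectionOnto (c b) = 0 := fun b hb =>
      Submodule.orthogonalProjectionOnto_eq_zero_iff.2
        (W.le_orthogonal_orthogonal (Submodule.subset_span ⟨b, hb, rfl⟩))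
    rw [show w = ∑ b, v b • c b from rfl, map_sum, Finset.sum_eq_single a]
    · rw [map_smul]
    · intro b _ hb
      rw [map_smul, hz b hb, smul_zero]
    · simp
  have hnorm : ‖w‖ ^ 2 = v a ^ 2 * ‖Wᗮ.orthogonalProjectionOnto (c a)‖ ^ 2 := by
    have : ‖Wᗮ.orthogonalProjectionOnto w‖ = ‖w‖ := by
      have := congrArg norm (Submodule.orthogonalProjectionOnto_mem_subspace_eq_self
        (⟨w, hwW⟩ : Wᗮ))
      simpa using this
    rw [← this, hproj, norm_smul, mul_pow, Real.norm_eq_abs, sq_abs]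
  have hva : v a ≠ 0 := by
    rw [← hww]
    intro h
    have h0 : w = 0 := by simpa using h
    have := hinner a
    rw [h0, inner_zero_right, if_pos rfl] at this
    exact zero_ne_one this
  refine eq_inv_of_mul_eq_one_left (mul_left_cancel₀ hva ?_)
  change v a * (v a * _) = v a * 1
  rw [mul_one, ← mul_assoc, ← sq, ← hnorm, hww]

/-- The inverse is positive semidefinite, even for dependent `c`, and its quadratic form at `e_a ±
e_b` bounds the off-diagonal entry. Thus integrability of the diagonal suffices. -/
lemma abs_inv_gram_apply_le {ι : Type*} [Fintype ι] [DecidableEq ι] (c : ι → E) (a b : ι) :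
    |(Matrix.gram ℝ c)⁻¹ a b| ≤ (Matrix.gram ℝ c)⁻¹ a a + (Matrix.gram ℝ c)⁻¹ b b := by
  have hpsd := (Matrix.posSemidef_gram ℝ c).inv
  have hsymm : (Matrix.gram ℝ c)⁻¹ b a = (Matrix.gram ℝ c)⁻¹ a b := by
    simpa using congrFun (congrFun hpsd.isHermitian.eq a) b
  have hd : ∀ i, 0 ≤ (Matrix.gram ℝ c)⁻¹ i i := fun i => hpsd.diag_nonneg
  have h1 := hpsd.dotProduct_mulVec_nonneg (Pi.single a 1 + Pi.single b 1)
  have h2 := hpsd.dotProduct_mulVec_nonneg (Pi.single a 1 - Pi.single b 1)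
  simp [Matrix.mulVec_add, Matrix.mulVec_sub, add_dotProduct, sub_dotProduct, hsymm] at h1 h2
  rw [abs_le]
  have := hd a
  have := hd b
  constructor <;> linarith

end GramInverse

/-! ### Gram matrices of independent standard Gaussian vectors -/

section GaussianGram

variable {E : Type*} [NormedAddCommGroup E] [InnerProductSpace ℝ E] [FiniteDimensional ℝ E]
  [MeasurableSpace E] [BorelSpace E]

lemma measurable_matrixGram_apply {ι : Type*} (a b : ι) :
    Measurable fun c : ι → E => Matrix.gram ℝ c a b := by
  simp only [Matrix.gram_apply]
  fun_prop

lemma measurableSet_linearIndependent {ι : Type*} [Fintype ι] [DecidableEq ι] :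
    MeasurableSet {c : ι → E | LinearIndependent ℝ c} := by
  simp only [← Matrix.det_gram_ne_zero_iff_linearIndependent]
  exact ((measurableSet_singleton (0 : ℝ)).preimage
    (measurable_det_real measurable_matrixGram_apply)).compl

/-- At most `finrank ℝ E` independent standard Gaussian vectors are linearly independent. -/
lemma ae_linearIndependent_stdGaussian :
    ∀ {d : ℕ}, d ≤ Module.finrank ℝ E →
      ∀ᵐ c ∂(Measure.pi fun _ : Fin d => stdGaussian E), LinearIndependent ℝ c
  | 0, _ => ae_of_all _ fun c => linearIndependent_empty_type
  | d + 1, hd => by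
    have hms : MeasurableSet {p : E × (Fin d → E) |
        LinearIndependent ℝ (Fin.cons p.1 p.2 : Fin (d + 1) → E)} := by
      refine measurableSet_linearIndependent.preimage (measurable_pi_lambda _ fun i => ?_)
      refine Fin.cases ?_ (fun j => ?_) i
      · simpa using measurable_fst
      · simpa [Function.comp_def] using (measurable_pi_apply j).comp measurable_snd
    have hprod : ∀ᵐ p ∂((stdGaussian E).prod (Measure.pi fun _ : Fin d => stdGaussian E)),
        LinearIndependent ℝ (Fin.cons p.1 p.2 : Fin (d + 1) → E) := by
      rw [Measure.ae_prod_iff_ae_ae hms]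
      refine (Measure.ae_ae_comm (p := fun x c =>
        LinearIndependent ℝ (Fin.cons x c : Fin (d + 1) → E)) hms).2 ?_
      -- With the other `d` vectors fixed, their span is a proper subspace, which the new Gaussian
      -- vector almost surely avoids.
      filter_upwards [ae_linearIndependent_stdGaussian (d := d) (by omega)] with c hc
      have hW : Submodule.span ℝ (Set.range c) ≠ ⊤ := fun h => by
        have := finrank_span_eq_card hc
        rw [h, finrank_top, Fintype.card_fin] at this
        omega
      filter_upwards [ae_notMem_stdGaussian hW] with x hx
      exact linearIndependent_finSucc.2 ⟨by simpa using hc, by simpa using hx⟩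
    have hmp := measurePreserving_piFinSuccAbove (fun _ : Fin (d + 1) => stdGaussian E) 0
    filter_upwards [hmp.quasiMeasurePreserving.ae hprod] with c hc
    convert hc using 1
    exact (Fin.cons_self_tail c).symm

/-- The expected diagonal entries of the inverse of a standard Wishart matrix. -/
lemma lintegral_inv_gram_apply_self {D : ℕ} (hD : D + 1 < Module.finrank ℝ E) (a : Fin D) :
    ∫⁻ c, ENNReal.ofReal ((Matrix.gram ℝ c)⁻¹ a a)
        ∂(Measure.pi fun _ : Fin D => stdGaussian E) =
      ENNReal.ofReal (1 / ((Module.finrank ℝ E : ℝ) - D - 1)) := by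
  obtain _ | d := D
  · exact a.elim0
  set G : (Fin (d + 1) → E) → ENNReal := fun c => ENNReal.ofReal ((Matrix.gram ℝ c)⁻¹ a a)
  have hG : Measurable G := (measurable_inv_apply measurable_matrixGram_apply a a).ennreal_ofReal
  -- Vector `a` is split off, so that the other `d` can be frozen and only it integrated.
  have hmp := (measurePreserving_piFinSuccAbove (fun _ : Fin (d + 1) => stdGaussian E) a).symm
  have hGmp : Measurable fun p => G ((MeasurableEquiv.piFinSuccAbove (fun _ => E) a).symm p) :=
    hG.comp (MeasurableEquiv.measurable _)
  have hli := (hmp.quasiMeasurePreserving.ae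
    (ae_linearIndependent_stdGaussian (E := E) (d := d + 1) (by omega)))
  have hms : MeasurableSet {p : E × (Fin d → E) | LinearIndependent ℝ
      ((MeasurableEquiv.piFinSuccAbove (fun _ : Fin (d + 1) => E) a).symm p)} :=
    measurableSet_linearIndependent.preimage (MeasurableEquiv.measurable _)
  rw [Measure.ae_prod_iff_ae_ae hms] at hli
  have hli' := (Measure.ae_ae_comm (p := fun x c => LinearIndependent ℝ
      ((MeasurableEquiv.piFinSuccAbove (fun _ : Fin (d + 1) => E) a).symm (x, c))) hms).1 hli
  rw [← hmp.lintegral_comp hG, lintegral_prod_symm' _ hGmp]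
  have hconst : ∀ᵐ c ∂(Measure.pi fun _ : Fin d => stdGaussian E),
      ∫⁻ x, G ((MeasurableEquiv.piFinSuccAbove (fun _ => E) a).symm (x, c)) ∂(stdGaussian E) =
        ENNReal.ofReal (1 / ((Module.finrank ℝ E : ℝ) - (d + 1 : ℕ) - 1)) := by
    filter_upwards [hli'] with c hc
    have hself : ∀ x, (MeasurableEquiv.piFinSuccAbove (fun _ : Fin (d + 1) => E) a).symm (x, c) a =
        x := fun x => Fin.insertNth_apply_same (α := fun _ => E) a x c
    have hother : ∀ x j, (MeasurableEquiv.piFinSuccAbove (fun _ : Fin (d + 1) => E) a).symm (x, c)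
        (a.succAbove j) = c j := fun x j => Fin.insertNth_apply_succAbove (α := fun _ => E) a x c j
    have himage : ∀ x, (MeasurableEquiv.piFinSuccAbove (fun _ : Fin (d + 1) => E) a).symm (x, c) ''
        {a}ᶜ = Set.range c := fun x => by
      rw [← Fin.range_succAbove, ← Set.range_comp]
      exact congrArg Set.range (funext fun j => hother x j)
    set W := Submodule.span ℝ (Set.range c)
    have hcli : LinearIndependent ℝ c := by
      obtain ⟨x, hx⟩ := hc.exists
      have := hx.comp _ (Fin.succAbove_right_injective (p := a))
      rwa [show _ ∘ a.succAbove = c from funext fun j => hother x j] at this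
    have hrank : Module.finrank ℝ Wᗮ = Module.finrank ℝ E - d := by
      have h1 : Module.finrank ℝ W = d := (finrank_span_eq_card hcli).trans (Fintype.card_fin d)
      have h2 := W.finrank_add_finrank_orthogonal
      omega
    have hcongr : ∫⁻ x, G ((MeasurableEquiv.piFinSuccAbove (fun _ => E) a).symm (x, c))
          ∂(stdGaussian E) =
        ∫⁻ x, (ENNReal.ofReal (‖Wᗮ.orthogonalProjectionOnto x‖ ^ 2))⁻¹ ∂(stdGaussian E) := by
      have hW : Wᗮ ≠ ⊥ := fun h => by
        rw [h, finrank_bot] at hrank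
        omega
      have hW' : W ≠ ⊤ := fun h => hW ((Submodule.orthogonal_eq_bot_iff).2 h)
      refine lintegral_congr_ae ?_
      filter_upwards [hc, ae_notMem_stdGaussian hW'] with x hx hxW
      have hpos : 0 < ‖Wᗮ.orthogonalProjectionOnto x‖ ^ 2 := by
        have : Wᗮ.orthogonalProjectionOnto x ≠ 0 := fun h => hxW (by
          rwa [Submodule.orthogonalProjectionOnto_eq_zero_iff,
            Submodule.orthogonal_orthogonal] at h)
        positivity
      rw [← ENNReal.ofReal_inv_of_pos hpos]
      have := inv_gram_apply_self hx a (congrArg (Submodule.span ℝ) (himage x))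
      rw [hself] at this
      exact congrArg ENNReal.ofReal this
    -- Here `D = d + 1`, so `D + 1 < finrank ℝ E` says exactly that `Wᗮ` has dimension at least `3`,
    -- and `finrank ℝ E - d - 2` is `finrank ℝ E - D - 1`.
    rw [hcongr, lintegral_stdGaussian_inv_norm_sq_orthogonalProjectionOnto (by omega), hrank,
      Nat.cast_sub (by omega)]
    push_cast
    ring_nf
  rw [lintegral_congr_ae hconst]
  simp

end GaussianGram

/-! ### Regression error for Gaussian inputs -/

section GaussianInputs

variable {n D : ℕ}

lemma gram_eq_matrixGram (X : Fin n → EuclideanSpace ℝ (Fin D)) :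
    gram X = Matrix.gram ℝ fun a => (WithLp.toLp 2 fun i => X i a : EuclideanSpace ℝ (Fin n)) := by
  ext a b
  simp [gram_apply, Matrix.gram_apply, PiLp.inner_apply, mul_comm]

lemma ae_isUnit_gram_stdGaussian (hD : D ≤ n) :
    ∀ᵐ X ∂(inputLaw n (stdGaussian (EuclideanSpace ℝ (Fin D)))), IsUnit (gram X) := by
  filter_upwards [(measurePreserving_transpose_stdGaussian n D).quasiMeasurePreserving.ae
    (ae_linearIndependent_stdGaussian (by simpa using hD))] with X hX
  rw [gram_eq_matrixGram, Matrix.isUnit_iff_isUnit_det, isUnit_iff_ne_zero]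
  exact Matrix.det_gram_ne_zero_iff_linearIndependent.2 hX

lemma integrable_and_integral_inv_gram_apply_self_stdGaussian (hD : D + 1 < n) (a : Fin D) :
    Integrable (fun X => (gram X)⁻¹ a a) (inputLaw n (stdGaussian (EuclideanSpace ℝ (Fin D)))) ∧
      ∫ X, (gram X)⁻¹ a a ∂(inputLaw n (stdGaussian (EuclideanSpace ℝ (Fin D)))) =
        1 / ((n : ℝ) - D - 1) := by
  have hn : (0 : ℝ) ≤ 1 / ((n : ℝ) - D - 1) := by
    have : (D : ℝ) + 1 < n := by exact_mod_cast hD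
    exact one_div_nonneg.2 (by linarith)
  refine integrable_and_integral_eq_of_lintegral_ofReal (measurable_inv_gram_apply a a)
    (fun X => ?_) hn ?_
  · rw [gram_eq_matrixGram]
    exact (Matrix.posSemidef_gram ℝ _).inv.diag_nonneg
  · simp only [gram_eq_matrixGram]
    have h := (measurePreserving_transpose_stdGaussian n D).lintegral_comp
      (measurable_inv_apply measurable_matrixGram_apply a a).ennreal_ofReal
    rw [h, lintegral_inv_gram_apply_self (by simpa using hD), finrank_euclideanSpace_fin]

lemma integrable_inv_gram_apply_stdGaussian (hD : D + 1 < n) (a b : Fin D) :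
    Integrable (fun X => (gram X)⁻¹ a b)
      (inputLaw n (stdGaussian (EuclideanSpace ℝ (Fin D)))) := by
  refine ((integrable_and_integral_inv_gram_apply_self_stdGaussian hD a).1.add
    (integrable_and_integral_inv_gram_apply_self_stdGaussian hD b).1).mono'
    (measurable_inv_gram_apply a b).aestronglyMeasurable (ae_of_all _ fun X => ?_)
  simp only [gram_eq_matrixGram, Pi.add_apply]
  exact abs_inv_gram_apply_le _ a b

lemma trace_expectedInvGram_stdGaussian (hD : D + 1 < n) :
    (expectedInvGram n (stdGaussian (EuclideanSpace ℝ (Fin D)))).trace =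
      (D : ℝ) / ((n : ℝ) - D - 1) := by
  simp only [Matrix.trace, Matrix.diag, expectedInvGram, Matrix.of_apply,
    (integrable_and_integral_inv_gram_apply_self_stdGaussian hD _).2]
  simp [div_eq_mul_inv]

lemma gram_toEuclideanCLM {A : Matrix (Fin D) (Fin D) ℝ} (hA : A.IsSymm)
    (X : Fin n → EuclideanSpace ℝ (Fin D)) :
    gram (fun i => toEuclideanCLM (𝕜 := ℝ) A (X i)) = A * gram X * A := by
  have h : designMatrix (fun i => toEuclideanCLM (𝕜 := ℝ) A (X i)) = designMatrix X * A := by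
    ext i d
    simp only [designMatrix, Matrix.of_apply, Matrix.mul_apply, ofLp_toEuclideanCLM,
      Matrix.mulVec, dotProduct]
    exact Finset.sum_congr rfl fun e _ => by rw [mul_comm, ← hA.apply d e]
  rw [gram, h, Matrix.transpose_mul, hA.eq, gram]
  simp only [Matrix.mul_assoc]

open scoped MatrixOrder in
lemma measurePreserving_inputLaw_multivariateGaussian (S : Matrix (Fin D) (Fin D) ℝ) :
    MeasurePreserving (fun (X : Fin n → EuclideanSpace ℝ (Fin D)) i =>
        toEuclideanCLM (𝕜 := ℝ) (CFC.sqrt S) (X i))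
      (inputLaw n (stdGaussian (EuclideanSpace ℝ (Fin D))))
      (inputLaw n (multivariateGaussian 0 S)) :=
  measurePreserving_pi _ _ fun _ => ⟨by fun_prop, by simp [multivariateGaussian]⟩

lemma secondMoment_multivariateGaussian {S : Matrix (Fin D) (Fin D) ℝ} (hS : S.PosSemidef) :
    secondMoment (multivariateGaussian 0 S) = S := by
  ext a b
  have hLp : ∀ d : Fin D, MemLp (fun x : EuclideanSpace ℝ (Fin D) => x d) 2
      (multivariateGaussian 0 S) := fun d =>
    (EuclideanSpace.proj (𝕜 := ℝ) d).comp_memLp' IsGaussian.memLp_two_id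
  have hmean : ∀ d : Fin D, ∫ x, x d ∂(multivariateGaussian 0 S) = 0 := fun d => by
    have := (EuclideanSpace.proj (𝕜 := ℝ) d).integral_comp_comm
      (IsGaussian.integrable_id (μ := multivariateGaussian (0 : EuclideanSpace ℝ (Fin D)) S))
    simpa using this
  have h := covariance_eval_multivariateGaussian (μ := 0) hS a b
  rw [covariance_eq_sub (hLp a) (hLp b), hmean, hmean, mul_zero, sub_zero] at h
  simpa [secondMoment] using h

open scoped MatrixOrder in
/-- The expected squared error of ordinary least squares for centered Gaussian inputs. -/
lemma hasRegressionMSE_multivariateGaussian {𝒟 : Kernel (ℝ × ℝ) ℝ} [IsMarkovKernel 𝒟]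
    (h𝒟 : IsSamplingFamily 𝒟) {Θ : Measure (EuclideanSpace ℝ (Fin D) × ℝ)}
    (hΘ : IsParameterLaw Θ) {S : Matrix (Fin D) (Fin D) ℝ} (hS : S.PosDef) (hD : D + 1 < n) :
    HasRegressionMSE n Θ (multivariateGaussian 0 S) 𝒟
      (expectedNoise Θ / ((n : ℝ) - D - 1) * D) := by
  -- Inputs of covariance `S` are `A` applied to standard Gaussian ones. As `A` is symmetric and
  -- invertible, the Gram matrix becomes `A G A`, with inverse `A⁻¹ G⁻¹ A⁻¹`.
  set A := CFC.sqrt S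
  have hAA : A * A = S := CFC.sqrt_mul_sqrt_self _ hS.posSemidef.nonneg
  have hAsymm : A.IsSymm := by
    have h : A.IsHermitian := (CFC.sqrt_nonneg S).isSelfAdjoint
    rwa [Matrix.IsHermitian, Matrix.conjTranspose_eq_transpose_of_trivial] at h
  have hAdet : IsUnit A.det := by
    have h := (Matrix.isUnit_iff_isUnit_det _).1 hS.isUnit
    rw [← hAA, Matrix.det_mul] at h
    exact isUnit_of_mul_isUnit_left h
  have hmp := measurePreserving_inputLaw_multivariateGaussian (n := n) S
  have hinv : ∀ (X : Fin n → EuclideanSpace ℝ (Fin D)) a b,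
      (gram fun i => toEuclideanCLM (𝕜 := ℝ) A (X i))⁻¹ a b =
        ∑ c, ∑ d, A⁻¹ a d * (gram X)⁻¹ d c * A⁻¹ c b := fun X a b => by
    rw [gram_toEuclideanCLM hAsymm, Matrix.mul_inv_rev, Matrix.mul_inv_rev, ← Matrix.mul_assoc]
    simp only [Matrix.mul_apply, Finset.sum_mul]
  have hterm : ∀ a b c d : Fin D, Integrable
      (fun X => A⁻¹ a d * (gram X)⁻¹ d c * A⁻¹ c b)
      (inputLaw n (stdGaussian (EuclideanSpace ℝ (Fin D)))) := fun a b c d =>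
    ((integrable_inv_gram_apply_stdGaussian hD d c).const_mul _).mul_const _
  have hmeas : ∀ a b : Fin D, AEStronglyMeasurable
      (fun X : Fin n → EuclideanSpace ℝ (Fin D) => (gram X)⁻¹ a b)
      (inputLaw n (multivariateGaussian 0 S)) := fun a b =>
    (measurable_inv_gram_apply a b).aestronglyMeasurable
  have hint : ∀ a b, Integrable (fun X => (gram X)⁻¹ a b)
      (inputLaw n (multivariateGaussian 0 S)) := fun a b => by
    rw [← hmp.integrable_comp (hmeas a b)]
    refine (integrable_finsetSum Finset.univ fun c _ => integrable_finsetSum Finset.univ fun d _ =>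
      hterm a b c d).congr (ae_of_all _ fun X => ?_)
    simpa using (hinv X a b).symm
  have hexp : expectedInvGram n (multivariateGaussian 0 S) =
      A⁻¹ * expectedInvGram n (stdGaussian (EuclideanSpace ℝ (Fin D))) * A⁻¹ := by
    ext a b
    simp only [Matrix.mul_apply, Finset.sum_mul, expectedInvGram, Matrix.of_apply]
    rw [← hmp.map_eq, integral_map hmp.measurable.aemeasurable (hmp.map_eq ▸ hmeas a b)]
    simp only [A] at hinv
    simp only [hinv]
    rw [integral_finsetSum _ fun c _ => integrable_finsetSum _ fun d _ => hterm a b c d]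
    refine Finset.sum_congr rfl fun c _ => ?_
    rw [integral_finsetSum _ fun d _ => hterm a b c d]
    refine Finset.sum_congr rfl fun d _ => ?_
    rw [integral_mul_const, integral_const_mul]
  have hunit : ∀ᵐ X ∂(inputLaw n (multivariateGaussian 0 S)), IsUnit (gram X) := by
    rw [← hmp.map_eq]
    have hset : MeasurableSet {X : Fin n → EuclideanSpace ℝ (Fin D) | IsUnit (gram X)} := by
      simp only [Matrix.isUnit_iff_isUnit_det, isUnit_iff_ne_zero]
      exact ((measurableSet_singleton (0 : ℝ)).preimage
        (measurable_det_real measurable_gram_apply)).compl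
    rw [ae_map_iff hmp.measurable.aemeasurable hset]
    filter_upwards [ae_isUnit_gram_stdGaussian (by omega : D ≤ n)] with X hX
    rw [gram_toEuclideanCLM hAsymm]
    have hA : IsUnit A := (Matrix.isUnit_iff_isUnit_det _).2 hAdet
    exact (hA.mul hX).mul hA
  have h := hasRegressionMSE_of_integrable h𝒟 hΘ
    (fun d => (EuclideanSpace.proj (𝕜 := ℝ) d).comp_memLp' IsGaussian.memLp_two_id) hunit hint
  convert h using 1
  -- Cyclicity of the trace brings the outer `A⁻¹` next to `S = A A`, so both inverse factors
  -- cancel.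
  have htrace : (S * (A⁻¹ * expectedInvGram n (stdGaussian (EuclideanSpace ℝ (Fin D))) *
      A⁻¹)).trace = (expectedInvGram n (stdGaussian (EuclideanSpace ℝ (Fin D)))).trace := by
    rw [← Matrix.mul_assoc, Matrix.trace_mul_comm, ← hAA, ← Matrix.mul_assoc, ← Matrix.mul_assoc,
      ← Matrix.mul_assoc, Matrix.nonsing_inv_mul _ hAdet, Matrix.one_mul,
      Matrix.mul_nonsing_inv _ hAdet, Matrix.one_mul]
  rw [secondMoment_multivariateGaussian hS.posSemidef, hexp, htrace,
    trace_expectedInvGram_stdGaussian hD]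
  ring

end GaussianInputs

/-! ### Mean estimation -/

section Mean

/-- The expected squared error of the sample mean. -/
lemma hasMeanMSE {n : ℕ} (hn : 1 ≤ n) {𝒟 : Kernel (ℝ × ℝ) ℝ} [IsMarkovKernel 𝒟]
    (h𝒟 : IsSamplingFamily 𝒟) {Θ : Measure (ℝ × ℝ)} (hΘ : IsParameterLaw Θ) :
    HasMeanMSE n Θ 𝒟 (expectedNoise Θ / n) := by
  have := hΘ.isProbabilityMeasure
  have : IsMarkovKernel (productKernel fun _ : Fin n => 𝒟) :=
    ⟨fun a => by change IsProbabilityMeasure (Measure.pi _); infer_instance⟩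
  have hn0 : (n : ℝ) ≠ 0 := by positivity
  have hmeas : Measurable (meanSqError : (ℝ × ℝ) × (Fin n → ℝ) → ℝ) := by
    unfold meanSqError
    fun_prop
  have herr : ∀ (p : ℝ × ℝ) (y : Fin n → ℝ),
      meanSqError (p, y) = (∑ i, (1 / (n : ℝ)) * (y i - p.1)) ^ 2 := fun p y => by
    rw [meanSqError, ← Finset.mul_sum, Finset.sum_sub_distrib]
    simp only [Finset.sum_const, Finset.card_univ, Fintype.card_fin, nsmul_eq_mul]
    congr 1
    field_simp
  refine integrable_and_integral_eq_of_lintegral_ofReal hmeas (fun ω => sq_nonneg _)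
    (div_nonneg (integral_nonneg_of_ae hΘ.noise_nonneg) n.cast_nonneg) ?_
  rw [meanLaw, Measure.lintegral_compProd hmeas.ennreal_ofReal, expectedNoise, ← integral_div,
    ofReal_integral_eq_lintegral_ofReal (hΘ.noise_integrable.div_const _)
      (hΘ.noise_nonneg.mono fun p hp => div_nonneg hp n.cast_nonneg)]
  refine lintegral_congr_ae ?_
  filter_upwards [hΘ.noise_nonneg] with p hp
  simp only [herr]
  refine (lintegral_pi_sq_weighted_sum (fun _ => 𝒟 p) (fun _ => p.1) (fun _ => 1 / (n : ℝ)) p.2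
    (fun _ => h𝒟.memLp p.1 p.2 hp) (fun _ => h𝒟.mean_eq p.1 p.2 hp)
    (fun _ => h𝒟.variance_eq p.1 p.2 hp)).trans ?_
  congr 1
  -- The `n` squared weights `1 / n²` add up to `1 / n`.
  simp only [Finset.sum_const, Finset.card_univ, Fintype.card_fin, nsmul_eq_mul]
  field_simp

end Mean

/-! ### Regression on a constant input -/

section ConstantInput

lemma ae_inputLaw_dirac {n D : ℕ} (x : EuclideanSpace ℝ (Fin D)) :
    ∀ᵐ X ∂(inputLaw n (Measure.dirac x)), X = fun _ => x := by
  have h : ∀ i : Fin n, ∀ᵐ X ∂(inputLaw n (Measure.dirac x)), X i = x := fun i =>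
    (measurePreserving_eval (fun _ : Fin n => Measure.dirac x) i).quasiMeasurePreserving.ae
      (ae_dirac_iff (measurableSet_singleton x) |>.2 rfl)
  filter_upwards [ae_all_iff.2 h] with X hX using funext hX

/-- Regression on the constant input `1` is mean estimation. -/
lemma hasRegressionMSE_dirac_one {n : ℕ} (hn : 1 ≤ n) {𝒟 : Kernel (ℝ × ℝ) ℝ} [IsMarkovKernel 𝒟]
    (h𝒟 : IsSamplingFamily 𝒟) {Θ : Measure (EuclideanSpace ℝ (Fin 1) × ℝ)}
    (hΘ : IsParameterLaw Θ) :
    HasRegressionMSE n Θ (Measure.dirac (WithLp.toLp 2 fun _ => (1 : ℝ))) 𝒟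
      (expectedNoise Θ / n) := by
  set e : EuclideanSpace ℝ (Fin 1) := WithLp.toLp 2 fun _ => (1 : ℝ)
  have hn0 : (n : ℝ) ≠ 0 := by positivity
  -- The Gram matrix is almost surely the `1 × 1` matrix `n`, so the hypotheses of the general
  -- formula hold and the trace is `n⁻¹`.
  have hgram : gram (fun _ : Fin n => e) = Matrix.diagonal fun _ => (n : ℝ) := by
    ext a b
    simp [gram_apply, e, Subsingleton.elim a b]
  have hinv : ∀ a b, (gram (fun _ : Fin n => e))⁻¹ a b = (n : ℝ)⁻¹ := fun a b => by
    rw [Subsingleton.elim b a, Matrix.inv_subsingleton, hgram]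
    simp [Ring.inverse_eq_inv']
  have hae := ae_inputLaw_dirac (n := n) e
  have : IsProbabilityMeasure (inputLaw n (Measure.dirac e)) := by
    unfold inputLaw; infer_instance
  have hconst : ∀ a b, (fun X => (gram X)⁻¹ a b) =ᵐ[inputLaw n (Measure.dirac e)]
      fun _ => (n : ℝ)⁻¹ := fun a b => hae.mono fun X hX => by
    simp only [hX, hinv]
  have h := hasRegressionMSE_of_integrable h𝒟 hΘ (𝒳 := Measure.dirac e) (n := n)
    (fun d => (memLp_const (e d)).ae_eq ((ae_eq_dirac fun x : EuclideanSpace ℝ (Fin 1) =>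
      x d).symm))
    (hae.mono fun X hX => by
      rw [hX, hgram, Matrix.isUnit_iff_isUnit_det]
      simpa using hn0.isUnit)
    (fun a b => (integrable_const _).congr (hconst a b).symm)
  have hexp : ∀ a b, expectedInvGram n (Measure.dirac e) a b = (n : ℝ)⁻¹ := fun a b => by
    rw [expectedInvGram, Matrix.of_apply, integral_congr_ae (hconst a b)]
    simp
  convert h using 1
  simp only [Matrix.trace, Matrix.diag, Matrix.mul_apply, hexp]
  simp [secondMoment, e, div_eq_mul_inv]

end ConstantInput

end LocalEstimation

theorem theorem1 (n : ℕ) (𝒟 : ProbabilityTheory.Kernel (ℝ × ℝ) ℝ)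
    [ProbabilityTheory.IsMarkovKernel 𝒟] (h𝒟 : LocalEstimation.IsSamplingFamily 𝒟) :
    -- Linear regression with an arbitrary input distribution.
    (∀ (D : ℕ) (Θ : MeasureTheory.Measure (EuclideanSpace ℝ (Fin D) × ℝ))
        (𝒳 : MeasureTheory.Measure (EuclideanSpace ℝ (Fin D))),
      LocalEstimation.IsParameterLaw Θ →
      MeasureTheory.IsProbabilityMeasure 𝒳 →
      (∀ d, MeasureTheory.MemLp (fun x : EuclideanSpace ℝ (Fin D) => x d) 2 𝒳) →
      (∀ᵐ X ∂(LocalEstimation.inputLaw n 𝒳), IsUnit (LocalEstimation.gram X)) →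
      (∀ a b, MeasureTheory.Integrable (fun X => (LocalEstimation.gram X)⁻¹ a b)
        (LocalEstimation.inputLaw n 𝒳)) →
      LocalEstimation.HasRegressionMSE n Θ 𝒳 𝒟
        (LocalEstimation.expectedNoise Θ *
          (LocalEstimation.secondMoment 𝒳 * LocalEstimation.expectedInvGram n 𝒳).trace)) ∧
    -- Linear regression with centered, nondegenerate Gaussian inputs.
    (∀ (D : ℕ) (Θ : MeasureTheory.Measure (EuclideanSpace ℝ (Fin D) × ℝ))
        (S : Matrix (Fin D) (Fin D) ℝ),
      LocalEstimation.IsParameterLaw Θ → S.PosDef → D + 1 < n →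
      LocalEstimation.HasRegressionMSE n Θ (ProbabilityTheory.multivariateGaussian 0 S) 𝒟
        (LocalEstimation.expectedNoise Θ / ((n : ℝ) - (D : ℝ) - 1) * (D : ℝ))) ∧
    -- Mean estimation by the sample mean.
    (∀ Θ : MeasureTheory.Measure (ℝ × ℝ),
      LocalEstimation.IsParameterLaw Θ → 1 ≤ n →
      LocalEstimation.HasMeanMSE n Θ 𝒟 (LocalEstimation.expectedNoise Θ / (n : ℝ))) ∧
    -- Mean estimation as the linear regression problem whose only input value is 1.
    (∀ Θ : MeasureTheory.Measure (EuclideanSpace ℝ (Fin 1) × ℝ),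
      LocalEstimation.IsParameterLaw Θ → 1 ≤ n →
      LocalEstimation.HasRegressionMSE n Θ
        (MeasureTheory.Measure.dirac (WithLp.toLp 2 fun _ => (1 : ℝ))) 𝒟
        (LocalEstimation.expectedNoise Θ / (n : ℝ))) := by
  exact ⟨fun _ _ _ hΘ _ h𝒳 hunit hint =>
      LocalEstimation.hasRegressionMSE_of_integrable h𝒟 hΘ h𝒳 hunit hint,
    fun _ _ _ hΘ hS hD => LocalEstimation.hasRegressionMSE_multivariateGaussian h𝒟 hΘ hS hD,
    fun _ hΘ hn => LocalEstimation.hasMeanMSE hn h𝒟 hΘ,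
    fun _ hΘ hn => LocalEstimation.hasRegressionMSE_dirac_one hn h𝒟 hΘ⟩
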